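/- All Borel spaces are standard and all Hilbert spaces are separable and complex. A Borel groupoid $G$ with unit space $G^{(0)}$, range and source maps $r,s$, is a groupoid with a Borel structure for which the operations are Borel. A measured groupoid $(G,C)$ is a Borel groupoid $G$ with the class $C$ of a probability measure on $G$ that is symmetric (invariant under $\gamma\mapsto\gamma^{-1}$ as a class) and invariant: some probability measure $\nu\in C$, with disintegration $(\nu^x)_{x\in G^{(0)}}$ along $r$, satisfies $\gamma\nu^{s(\gamma)}\sim\nu^{r(\gamma)}$ for almost every $\gamma$. Let $r(C)$ be the class of $r_*\nu$, and $C^{(2)}$ the class on composable pairs of the measure $f\mapsto\iiint f(\gamma_1^{-1},\gamma_2)\,d\nu^x(\gamma_1)\,d\nu^x(\gamma_2)\,d(r_*\nu)(x)$. $(G,C)$ is ergodic if every invariant Borel subset of $G^{(0)}$ is null or conull for $r(C)$. A representation $(G^{(0)}*\mathcal H,L)$ of $(G,C)$ consists of a Hilbert bundle $(\mathcal H(x))_{x\in G^{(0)}}$ and a Borel family of operators $L(\gamma):\mathcal H(s(\gamma))\to\mathcal H(r(\gamma))$ which, over some conull Borel set $U\subset G^{(0)}$, i.e. for $\gamma$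 with $r(\gamma),s(\gamma)\in U$, are surjective isometries, preserve units and satisfy $L(\gamma_1\gamma_2)=L(\gamma_1)L(\gamma_2)$. For a Borel section $\xi$ of $\mathcal H$ put $c_L(\xi)(\gamma)=\xi(r(\gamma))-L(\gamma)\xi(s(\gamma))$. Let $Z^1((G,C),L)$ be the space of Borel maps $\gamma\mapsto b(\gamma)\in\mathcal H(r(\gamma))$ with $b(\gamma_1\gamma_2)=b(\gamma_1)+L(\gamma_1)b(\gamma_2)$ $C^{(2)}$-almost everywhere, modulo equality $C$-almost everywhere, let $B^1((G,C),L)$ be the subspace of those equal $C$-a.e. to $c_L(\xi)$ for some Borel section $\xi$, and $H^1((G,C),L)=Z^1((G,C),L)/B^1((G,C),L)$. A unit section is a Borel section $\xi$ with $\|\xi(x)\|=1$ for $r(C)$-almost every $x$. $(G,C)$ has property T if every representation $L$ for which there are unit sections $\xi_n$ with $c_L(\xi_n)\to 0$ $C$-a.e. admits a unit section $\xi$ with $c_L(\xi)=0$ $C$-a.e. Theorem. Let $(G,C)$ be an ergodic measured groupoid such that $H^1((G,C),L)=0$ for every representation $(G^{(0)}*\mathcal H,L)$ of $(G,C)$.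 Then $(G,C)$ has property T. -/

import Mathlib

open MeasureTheory ProbabilityTheory CategoryTheory Filter Topology

universe u v w

noncomputable section

namespace MeasGpd

/-! ### Borel groupoids

A groupoid with unit space `X` is a category on `X` all of whose arrows are invertible; its total space
of arrows is `Quiver.Total X`. An arrow `γ : y ⟶ x` has source `s(γ) = y` (`left`) and range
`r(γ) = x` (`right`), and the groupoid product `γ₁γ₂` of `γ₁ : y ⟶ x` and `γ₂ : z ⟶ y`
is the composite `γ₂ ≫ γ₁ : z ⟶ x`. -/

section Groupoid

variable {X : Type u} [Groupoid.{v} X]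

/-- The inverse `γ⁻¹`. -/
def arrowInv (γ : Quiver.Total X) : Quiver.Total X := ⟨γ.right, γ.left, Groupoid.inv γ.hom⟩

/-- The unit arrow at `x`. -/
def arrowUnit (x : X) : Quiver.Total X := ⟨x, x, 𝟙 x⟩

/-- The product `γ₁γ₂`, defined when `s(γ₁) = r(γ₂)`. -/
def arrowMul (γ₁ γ₂ : Quiver.Total X) (h : γ₁.left = γ₂.right) : Quiver.Total X :=
  ⟨γ₂.left, γ₁.right, γ₂.hom ≫ eqToHom h.symm ≫ γ₁.hom⟩

end Groupoid

/-- A Borel groupoid: the unit space and the space of arrows are standard Borel spaces, and all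
operations are Borel maps. -/
class BorelGroupoid (X : Type u) [MeasurableSpace X] [Groupoid.{v} X]
    [MeasurableSpace (Quiver.Total X)] : Prop where
  standardUnits : StandardBorelSpace X
  standardArrows : StandardBorelSpace (Quiver.Total X)
  measurable_range : Measurable fun γ : Quiver.Total X => γ.right
  measurable_source : Measurable fun γ : Quiver.Total X => γ.left
  measurable_unit : Measurable (arrowUnit : X → Quiver.Total X)
  measurable_inv : Measurable (arrowInv : Quiver.Total X → Quiver.Total X)
  measurable_mul : Measurable
    fun p : {p : Quiver.Total X × Quiver.Total X // p.1.left = p.2.right} =>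
      arrowMul p.1.1 p.1.2 p.2

attribute [instance] BorelGroupoid.standardUnits BorelGroupoid.standardArrows

section Measured

variable {X : Type u} [MeasurableSpace X] [Groupoid.{v} X] [MeasurableSpace (Quiver.Total X)]
  [BorelGroupoid X]

/-- The image `r_*(ν)` of `ν` on the unit space. -/
def unitMeasure (ν : Measure (Quiver.Total X)) : Measure X :=
  ν.map fun γ => γ.right

/-- The disintegration `x ↦ ν^x` of a probability measure `ν` with respect to the range map:
`ν^x` is carried by the fibre `r⁻¹(x)` for almost every `x`, and `ν = ∫ ν^x d(r_*ν)(x)`. -/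
def rangeDisintegration (ν : Measure (Quiver.Total X)) [IsProbabilityMeasure ν] :
    Kernel X (Quiver.Total X) :=
  haveI : Nonempty (Quiver.Total X) := nonempty_of_isProbabilityMeasure ν
  condDistrib id (fun γ : Quiver.Total X => γ.right) ν

/-- The left translate `γ m` of a measure `m` carried by the fibre `r⁻¹(s(γ))`: its image under
`γ' ↦ γγ'`. -/
def translate (γ : Quiver.Total X) (m : Measure (Quiver.Total X)) : Measure (Quiver.Total X) :=
  (m.comap (Subtype.val : {γ' : Quiver.Total X // γ.left = γ'.right} → Quiver.Total X)).map
    fun γ' => arrowMul γ γ'.1 γ'.2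

/-- Two measures are equivalent: they have the same null sets. -/
def Equivalent {α : Type*} [MeasurableSpace α] (m m' : Measure α) : Prop := m ≪ m' ∧ m' ≪ m

/-- The class of the measure `ν` is symmetric. -/
def IsSymmetricClass (ν : Measure (Quiver.Total X)) : Prop :=
  Equivalent (ν.map arrowInv) ν

/-- The class of the measure `ν` is invariant: it contains a probability measure `ν'` such that
`γ ν'^{s(γ)}` is equivalent to `ν'^{r(γ)}` for almost every `γ`. -/
def IsInvariantClass (ν : Measure (Quiver.Total X)) : Prop :=
  ∃ (ν' : Measure (Quiver.Total X)) (_ : IsProbabilityMeasure ν'), Equivalent ν' ν ∧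
    ∀ᵐ γ ∂ν', Equivalent (translate γ (rangeDisintegration ν' γ.left))
      (rangeDisintegration ν' γ.right)

/-- `(G, C)` is a measured groupoid, where `G` is the Borel groupoid with unit space `X` and `C` is
the measure class of the probability measure `ν` on `G`. A measure class is given by any probability
measure in it; every notion defined from `ν` below depends only on the null sets of `ν`. -/
structure IsMeasuredGroupoid (ν : Measure (Quiver.Total X)) : Prop where
  symmetric : IsSymmetricClass ν
  invariant : IsInvariantClass ν

/-- Ergodicity: every invariant Borel set of units is null or conull. -/
def IsErgodic (ν : Measure (Quiver.Total X)) : Prop :=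
  ∀ A : Set X, MeasurableSet A → (∀ x y : X, ∀ _ : y ⟶ x, x ∈ A ↔ y ∈ A) →
    unitMeasure ν A = 0 ∨ unitMeasure ν Aᶜ = 0

/-- A measure in the class `C^(2)` on pairs of arrows, carried by the composable ones:
`f ↦ ∫ f(γ₁⁻¹, γ₂) dν^x(γ₁) dν^x(γ₂) d(r_*ν)(x)`. -/
def pairMeasure (ν : Measure (Quiver.Total X)) [IsProbabilityMeasure ν] :
    Measure (Quiver.Total X × Quiver.Total X) :=
  (unitMeasure ν).bind ((rangeDisintegration ν).map arrowInv ×ₖ rangeDisintegration ν)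

end Measured

/-! ### Hilbert bundles -/

/-- A (complex) Hilbert bundle on `X`: Hilbert spaces `fibre x`, with a standard Borel structure on
`{(x, v) : v ∈ fibre x}` for which a set of base points is Borel iff its preimage is, and which has a
fundamental sequence of sections. The fibres are separable, since by the last
condition the vectors `ξ n x` span a dense subspace of `fibre x`. -/
structure HilbertBundle (X : Type u) [MeasurableSpace X] where
  fibre : X → Type w
  [normed : ∀ x, NormedAddCommGroup (fibre x)]
  [innerProduct : ∀ x, InnerProductSpace ℂ (fibre x)]
  [complete : ∀ x, CompleteSpace (fibre x)]
  [borel : MeasurableSpace (Σ x, fibre x)]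
  [standard : StandardBorelSpace (Σ x, fibre x)]
  measurableSet_iff : ∀ E : Set X, MeasurableSet E ↔
    MeasurableSet ((Sigma.fst : (Σ x, fibre x) → X) ⁻¹' E)
  exists_fundamental : ∃ ξ : ℕ → ∀ x, fibre x,
    (∀ n, Measurable fun x => (⟨x, ξ n x⟩ : Σ x, fibre x)) ∧
    (∀ n, Measurable fun z : (Σ x, fibre x) => inner ℂ (ξ n z.1) z.2) ∧
    (∀ m n, Measurable fun x => inner ℂ (ξ m x) (ξ n x)) ∧
    ∀ x (v v' : fibre x), (∀ n, inner ℂ (ξ n x) v = inner ℂ (ξ n x) v') → v = v'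

namespace HilbertBundle

attribute [instance] HilbertBundle.normed HilbertBundle.innerProduct HilbertBundle.complete
  HilbertBundle.borel HilbertBundle.standard

variable {X : Type u} [MeasurableSpace X] (B : HilbertBundle.{u, w} X)

/-- `b` is a Borel section of the pull-back of the bundle along `p : Y → X`;
for `p` the identity it is a Borel section of the bundle itself. -/
def IsSection {Y : Type*} [MeasurableSpace Y] (p : Y → X) (b : ∀ y, B.fibre (p y)) : Prop :=
  Measurable fun y => (⟨p y, b y⟩ : Σ x, B.fibre x)

variable {B}

lemma measurable_fst : Measurable (Sigma.fst : (Σ x, B.fibre x) → X) :=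
  fun E hE => (B.measurableSet_iff E).1 hE

/-- The Borel structure of the bundle is determined by a fundamental sequence. -/
lemma exists_measurableEmbedding [StandardBorelSpace X]
    (B : HilbertBundle.{u, w} X) :
    ∃ ξ : ℕ → ∀ x, B.fibre x, MeasurableEmbedding
      fun z : (Σ x, B.fibre x) => (z.1, fun n => (inner ℂ (ξ n z.1) z.2 : ℂ)) := by
  obtain ⟨ξ, -, h1, -, h3⟩ := B.exists_fundamental
  refine ⟨ξ, (measurable_fst.prodMk (measurable_pi_lambda _ h1)).measurableEmbedding ?_⟩
  rintro ⟨x, v⟩ ⟨x', v'⟩ h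
  obtain rfl : x = x' := congrArg Prod.fst h
  rw [h3 x v v' fun n => congrFun (congrArg Prod.snd h) n]

/-- A section is Borel iff its inner products with a fundamental sequence are. -/
lemma exists_isSection_iff [StandardBorelSpace X] (B : HilbertBundle.{u, w} X)
    {Y : Type*} [MeasurableSpace Y] (p : Y → X) (hp : Measurable p) :
    ∃ ξ : ℕ → ∀ x, B.fibre x, ∀ b : ∀ y, B.fibre (p y),
      B.IsSection p b ↔ ∀ n, Measurable fun y => (inner ℂ (ξ n (p y)) (b y) : ℂ) := by
  obtain ⟨ξ, hξ⟩ := B.exists_measurableEmbedding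
  refine ⟨ξ, fun b => ?_⟩
  rw [IsSection, ← hξ.measurable_comp_iff]
  refine ⟨fun h n => (measurable_pi_apply n).comp (measurable_snd.comp h), fun h => ?_⟩
  exact hp.prodMk (measurable_pi_lambda _ h)

/-- The vector space of Borel sections of the pull-back of the bundle along a Borel map. -/
def sections [StandardBorelSpace X] (B : HilbertBundle.{u, w} X)
    {Y : Type*} [MeasurableSpace Y] (p : Y → X) (hp : Measurable p) :
    Submodule ℂ (∀ y, B.fibre (p y)) where
  carrier := {b | B.IsSection p b}
  zero_mem' := by
    obtain ⟨ξ, hξ⟩ := B.exists_isSection_iff p hp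
    exact (hξ _).2 fun n => by simp
  add_mem' := by
    obtain ⟨ξ, hξ⟩ := B.exists_isSection_iff p hp
    intro a b ha hb
    refine (hξ _).2 fun n => ?_
    simp only [Pi.add_apply, inner_add_right]
    exact ((hξ a).1 ha n).add ((hξ b).1 hb n)
  smul_mem' := by
    obtain ⟨ξ, hξ⟩ := B.exists_isSection_iff p hp
    intro c a ha
    refine (hξ _).2 fun n => ?_
    simp only [Pi.smul_apply, inner_smul_right]
    exact ((hξ a).1 ha n).const_mul c

end HilbertBundle

/-! ### Representations, cohomology and property T -/

section Cohomology

variable {X : Type u} [MeasurableSpace X] [Groupoid.{v} X] [MeasurableSpace (Quiver.Total X)]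
  [BorelGroupoid X]

/-- A representation of the measured groupoid `(G, [ν])`: a Hilbert bundle on the unit space and a
Borel family of operators `L(γ) : fibre s(γ) → fibre r(γ)` which, on the reduction `G|_U` to some
conull Borel set `U` of units, are surjective isometries and multiplicative. The values
outside `G|_U`, a null set of arrows, are irrelevant (they may be taken to be `0`). Since every Borel
section is a pointwise limit of combinations of a fundamental sequence with Borel coefficients, it
amounts to the same to ask for Borel coefficients on all Borel sections or on a fundamental
sequence. -/
structure Representation (ν : Measure (Quiver.Total X)) where
  bundle : HilbertBundle.{u, w} X
  op : ∀ {x y : X}, (y ⟶ x) → bundle.fibre y →L[ℂ] bundle.fibre x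
  measurable_coeff : ∀ ξ η : ∀ x, bundle.fibre x,
    bundle.IsSection (fun x => x) ξ → bundle.IsSection (fun x => x) η →
    Measurable fun γ : Quiver.Total X => inner ℂ (op γ.hom (ξ γ.left)) (η γ.right)
  exists_reduction : ∃ U : Set X, MeasurableSet U ∧ unitMeasure ν Uᶜ = 0 ∧
    (∀ x ∈ U, op (𝟙 x) = ContinuousLinearMap.id ℂ (bundle.fibre x)) ∧
    (∀ x ∈ U, ∀ y ∈ U, ∀ γ : y ⟶ x, (∀ a, ‖op γ a‖ = ‖a‖) ∧ Function.Surjective (op γ)) ∧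
    ∀ x ∈ U, ∀ y ∈ U, ∀ z ∈ U, ∀ (γ₁ : y ⟶ x) (γ₂ : z ⟶ y),
      op (γ₂ ≫ γ₁) = (op γ₁).comp (op γ₂)

variable {ν : Measure (Quiver.Total X)}

/-- The coboundary `c_L(ξ)(γ) = ξ(r(γ)) - L(γ) ξ(s(γ))`. -/
def coboundary (L : Representation.{u, v, w} ν) (ξ : ∀ x, L.bundle.fibre x)
    (γ : Quiver.Total X) : L.bundle.fibre γ.right :=
  ξ γ.right - L.op γ.hom (ξ γ.left)

/-- The cocycle identity `b(γ₁γ₂) = b(γ₁) + L(γ₁) b(γ₂)` holds for almost every composable pair. -/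
def CocycleAE [IsProbabilityMeasure ν] (L : Representation.{u, v, w} ν)
    (b : ∀ γ : Quiver.Total X, L.bundle.fibre γ.right) : Prop :=
  ∀ᵐ p ∂(pairMeasure ν), ∀ (x y z : X) (γ₁ : y ⟶ x) (γ₂ : z ⟶ y),
    p = ((⟨y, x, γ₁⟩ : Quiver.Total X), (⟨z, y, γ₂⟩ : Quiver.Total X)) →
    b ⟨z, x, γ₂ ≫ γ₁⟩ = b ⟨y, x, γ₁⟩ + L.op γ₁ (b ⟨z, y, γ₂⟩)

/-- The space of almost everywhere `L`-cocycles, that is, Borel sections of the pull-back of the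
bundle along the range map that satisfy the cocycle identity almost everywhere. -/
def Z1 [IsProbabilityMeasure ν] (L : Representation.{u, v, w} ν) :
    Submodule ℂ (∀ γ : Quiver.Total X, L.bundle.fibre γ.right) where
  carrier := {b | b ∈ L.bundle.sections (fun γ : Quiver.Total X => γ.right)
    BorelGroupoid.measurable_range ∧ CocycleAE L b}
  zero_mem' := ⟨Submodule.zero_mem _, Eventually.of_forall fun _ _ _ _ _ _ _ => by simp⟩
  add_mem' := by
    rintro a b ⟨ha, ha'⟩ ⟨hb, hb'⟩
    refine ⟨Submodule.add_mem _ ha hb, ?_⟩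
    filter_upwards [ha', hb'] with p h1 h2 x y z γ₁ γ₂ hp
    simp only [Pi.add_apply, h1 x y z γ₁ γ₂ hp, h2 x y z γ₁ γ₂ hp, map_add]
    abel
  smul_mem' := by
    rintro c a ⟨ha, ha'⟩
    refine ⟨Submodule.smul_mem _ c ha, ?_⟩
    filter_upwards [ha'] with p h1 x y z γ₁ γ₂ hp
    simp only [Pi.smul_apply, h1 x y z γ₁ γ₂ hp, map_smul, smul_add]

/-- The `L`-coboundaries among the cocycles: those equal almost everywhere to `c_L(ξ)` for some
Borel section `ξ`. They contain all cocycles that vanish almost everywhere. -/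
def B1 [IsProbabilityMeasure ν] (L : Representation.{u, v, w} ν) : Submodule ℂ (Z1 L) where
  carrier := {b | ∃ ξ ∈ L.bundle.sections (fun x : X => x) measurable_id, ∀ᵐ γ ∂ν, b.1 γ = coboundary L ξ γ}
  zero_mem' := ⟨0, Submodule.zero_mem _, Eventually.of_forall fun γ => by simp [coboundary]⟩
  add_mem' := by
    rintro a b ⟨ξ, hξ, h1⟩ ⟨η, hη, h2⟩
    refine ⟨ξ + η, Submodule.add_mem _ hξ hη, ?_⟩
    filter_upwards [h1, h2] with γ h1 h2
    simp only [Submodule.coe_add, Pi.add_apply, h1, h2, coboundary, map_add]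
    abel
  smul_mem' := by
    rintro c a ⟨ξ, hξ, h1⟩
    refine ⟨c • ξ, Submodule.smul_mem _ c hξ, ?_⟩
    filter_upwards [h1] with γ h1
    simp only [Submodule.coe_smul, Pi.smul_apply, h1, coboundary, map_smul, smul_sub]

/-- The first cohomology group `H¹((G, C), L)`. Cocycles that agree almost everywhere have the same
class, as `B1` contains the null cocycles. -/
abbrev H1 [IsProbabilityMeasure ν] (L : Representation.{u, v, w} ν) : Type (max u v w) :=
  Z1 L ⧸ B1 L

/-- `ξ` is a unit section: a Borel section with `‖ξ(x)‖ = 1` for almost every unit `x`. -/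
def IsUnitSection (L : Representation.{u, v, w} ν) (ξ : ∀ x, L.bundle.fibre x) : Prop :=
  L.bundle.IsSection (fun x => x) ξ ∧ ∀ᵐ x ∂(unitMeasure ν), ‖ξ x‖ = 1

/-- `L` contains a unit invariant section. -/
def ContainsUnitInvariantSection (L : Representation.{u, v, w} ν) : Prop :=
  ∃ ξ : ∀ x, L.bundle.fibre x, IsUnitSection L ξ ∧
    ∀ᵐ γ ∂ν, ξ γ.right = L.op γ.hom (ξ γ.left)

/-- `L` almost contains unit invariant sections: there are unit sections `ξₙ` with
`c_L(ξₙ) → 0` almost everywhere. -/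
def AlmostContainsUnitInvariantSections (L : Representation.{u, v, w} ν) : Prop :=
  ∃ ξ : ℕ → ∀ x, L.bundle.fibre x, (∀ n, IsUnitSection L (ξ n)) ∧
    ∀ᵐ γ ∂ν, Tendsto (fun n => coboundary L (ξ n) γ) atTop (𝓝 0)

variable (ν) in
/-- Property T. -/
def PropertyT : Prop :=
  ∀ L : Representation.{u, v, w} ν,
    AlmostContainsUnitInvariantSections L → ContainsUnitInvariantSection L

end Cohomology

end MeasGpd

end

/-!
The proof is Guichardet's: if `L` almost contains unit invariant sections, a cocycle of
`L ⊕ L ⊕ ⋯` is built which is formally the coboundary of a section of infinite norm.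

Let `ξₙ` be unit sections with `c_L(ξₙ) → 0` almost everywhere. By Borel-Cantelli
(`exists_seq_ae_summable_sq`) some terms of the sequence, again written `ξₖ`, satisfy
`∑ₖ ‖c_L(k ξₖ)(γ)‖² < ∞` for almost every `γ`, so that `⊕ₖ c_L(k ξₖ)` is an almost everywhere
cocycle of the `ℓ²` sum of `L` (`cocycleAE_sumCoboundary`). As the cohomology vanishes it is the coboundary
of some section `⊕ₖ ηₖ` of the sum bundle, that is, every section `ζₖ = k ξₖ - ηₖ` is invariant
(`exists_invariant_sub`). Here `‖k ξₖ(x)‖ = k` for almost every `x`, while `ηₖ(x) → 0`; hence some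
`ζₖ(x)` is nonzero. The least such `k` is an invariant function of `x`, so the sections `ζₖ` can be
glued along it and normalised to an invariant unit section
(`containsUnitInvariantSection_of_seq`).

The bulk of the work is the construction of the `ℓ²` sum of a Hilbert bundle
(`HilbertBundle.ellTwo`). Its total space gets its Borel structure from the injection
`(x, v) ↦ ((x, v₀), (x, v₁), …)`, whose image is Borel because the norm is a Borel function on
the total space of a Hilbert bundle (`HilbertBundle.measurable_norm_snd`).
-/

noncomputable section

namespace MeasGpd

/-! ### Borel sections of a Hilbert bundle -/

/-- The square norm as a supremum of inner products with a dense family, by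
`2 Re ⟪q, v⟫ - ‖q‖² = ‖v‖² - ‖q - v‖²`. It shows that the norm of a Hilbert bundle is Borel. -/
lemma iSup_two_re_inner_sub_norm_sq {E : Type*} [NormedAddCommGroup E] [InnerProductSpace ℂ E]
    {ι : Type*} {q : ι → E} (hq : DenseRange q) (v : E) :
    ⨆ i, ENNReal.ofReal (2 * (inner ℂ (q i) v).re - (inner ℂ (q i) (q i) : ℂ).re) =
      ENNReal.ofReal (‖v‖ ^ 2) := by
  have key (i : ι) : 2 * (inner ℂ (q i) v).re - (inner ℂ (q i) (q i) : ℂ).re =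
      ‖v‖ ^ 2 - ‖q i - v‖ ^ 2 := by
    have h1 := norm_sub_sq (𝕜 := ℂ) (q i) v
    have h2 : (inner ℂ (q i) (q i) : ℂ).re = ‖q i‖ ^ 2 := inner_self_eq_norm_sq (𝕜 := ℂ) (q i)
    rw [h1, h2]
    simp only [RCLike.re_to_complex]
    ring
  simp only [key]
  refine le_antisymm (iSup_le fun i => ENNReal.ofReal_le_ofReal (by linarith [sq_nonneg ‖q i - v‖]))
    ?_
  refine le_of_forall_lt fun c hc => ?_
  have hcont : Continuous fun u : E => ENNReal.ofReal (‖v‖ ^ 2 - ‖u - v‖ ^ 2) :=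
    ENNReal.continuous_ofReal.comp (by fun_prop)
  obtain ⟨i, hi⟩ := hq.exists_mem_open ((isOpen_Ioi (a := c)).preimage hcont)
    ⟨v, by simpa only [Set.mem_preimage, Set.mem_Ioi, sub_self, norm_zero, zero_pow two_ne_zero,
      sub_zero] using hc⟩
  exact lt_of_lt_of_le hi (le_iSup (fun i => ENNReal.ofReal (‖v‖ ^ 2 - ‖q i - v‖ ^ 2)) i)

/-- A countable dense family of combinations of a separating sequence. Its coefficients do not
depend on the Hilbert space, so that over a bundle the same indices serve all fibres. -/
lemma denseRange_sum_denseSeq_smul {E : Type*} [NormedAddCommGroup E] [InnerProductSpace ℂ E]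
    [CompleteSpace E] {ξ : ℕ → E}
    (hξ : ∀ v v' : E, (∀ n, inner ℂ (ξ n) v = inner ℂ (ξ n) v') → v = v') :
    DenseRange fun p : ℕ × ℕ =>
      ∑ i : Fin p.1, TopologicalSpace.denseSeq (Fin p.1 → ℂ) p.2 i • ξ i := by
  have hspan : Dense (Submodule.span ℂ (Set.range ξ) : Set E) := by
    rw [Submodule.dense_iff_topologicalClosure_eq_top, Submodule.topologicalClosure_eq_top_iff,
      Submodule.eq_bot_iff]
    intro v hv
    refine hξ v 0 fun n => ?_
    rw [inner_zero_right]
    exact (Submodule.mem_orthogonal _ _).1 hv _ (Submodule.subset_span ⟨n, rfl⟩)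
  rw [DenseRange, dense_iff_inter_open]
  intro U hU hne
  obtain ⟨y, hyU, hy⟩ := hspan.inter_open_nonempty U hU hne
  obtain ⟨c, rfl⟩ := (Finsupp.mem_span_range_iff_exists_finsupp).1 hy
  obtain ⟨N, hN⟩ := c.support.exists_nat_subset_range
  have hc : (c.sum fun i a => a • ξ i) = ∑ i : Fin N, c i • ξ i := by
    rw [Finset.sum_fin_eq_sum_range]
    rw [Finsupp.sum_of_support_subset _ hN _ (by simp)]
    exact Finset.sum_congr rfl fun i hi => by simp [Finset.mem_range.1 hi]
  rw [hc] at hyU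
  have hcont : Continuous fun a : Fin N → ℂ => ∑ i : Fin N, a i • ξ i := by fun_prop
  obtain ⟨m, hm⟩ := (TopologicalSpace.denseRange_denseSeq (Fin N → ℂ)).exists_mem_open
    (hU.preimage hcont) ⟨fun i => c i, hyU⟩
  exact ⟨_, hm, (N, m), rfl⟩

namespace HilbertBundle

variable {X : Type u} [MeasurableSpace X] (B : HilbertBundle.{u, w} X)

lemma measurable_norm_snd : Measurable fun z : (Σ x, B.fibre x) => ‖z.2‖ := by
  obtain ⟨ξ, -, h1, h2, h3⟩ := B.exists_fundamental
  have hsq (z : Σ x, B.fibre x) := iSup_two_re_inner_sub_norm_sq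
    (denseRange_sum_denseSeq_smul (h3 z.1)) z.2
  have hm : Measurable fun z : (Σ x, B.fibre x) => ENNReal.ofReal (‖z.2‖ ^ 2) := by
    simp only [← hsq, sum_inner, inner_sum, inner_smul_left, inner_smul_right]
    refine Measurable.iSup fun p => ?_
    have h2' (m n : ℕ) : Measurable fun z : (Σ x, B.fibre x) => (inner ℂ (ξ m z.1) (ξ n z.1) : ℂ) :=
      (h2 m n).comp measurable_fst
    fun_prop
  have := hm.ennreal_toReal.sqrt
  simpa [ENNReal.toReal_ofReal, Real.sqrt_sq] using this

variable {B}

section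

variable {Y : Type*} [MeasurableSpace Y] {p : Y → X}

lemma IsSection.measurable_base {b : ∀ y, B.fibre (p y)} (hb : B.IsSection p b) :
    Measurable p :=
  measurable_fst.comp hb

lemma IsSection.measurable_norm {b : ∀ y, B.fibre (p y)} (hb : B.IsSection p b) :
    Measurable fun y => ‖b y‖ :=
  B.measurable_norm_snd.comp hb

lemma IsSection.comp {Z : Type*} [MeasurableSpace Z] {b : ∀ y, B.fibre (p y)}
    (hb : B.IsSection p b) {f : Z → Y} (hf : Measurable f) :
    B.IsSection (fun z => p (f z)) fun z => b (f z) :=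
  Measurable.comp hb hf

lemma IsSection.measurableSet_ne_zero {b : ∀ y, B.fibre (p y)} (hb : B.IsSection p b) :
    MeasurableSet {y | b y ≠ 0} := by
  have := hb.measurable_norm (measurableSet_singleton (0 : ℝ)).compl
  convert this using 1
  ext y
  simp

variable [StandardBorelSpace X]

/-- A family of vectors is a Borel section as soon as its inner products with all Borel sections of
the bundle are Borel. -/
lemma IsSection.of_forall_inner (hp : Measurable p) {b : ∀ y, B.fibre (p y)}
    (hb : ∀ ξ : ∀ x, B.fibre x, B.IsSection (fun x => x) ξ →
      Measurable fun y => (inner ℂ (ξ (p y)) (b y) : ℂ)) : B.IsSection p b := by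
  obtain ⟨ξ, h0, h1, -, h3⟩ := B.exists_fundamental
  have hemb : MeasurableEmbedding
      fun z : (Σ x, B.fibre x) => (z.1, fun n => (inner ℂ (ξ n z.1) z.2 : ℂ)) := by
    refine (measurable_fst.prodMk (measurable_pi_lambda _ h1)).measurableEmbedding ?_
    rintro ⟨x, v⟩ ⟨x', v'⟩ h
    obtain rfl : x = x' := congrArg Prod.fst h
    rw [h3 x v v' fun n => congrFun (congrArg Prod.snd h) n]
  rw [IsSection, ← hemb.measurable_comp_iff]
  exact hp.prodMk (measurable_pi_lambda _ fun n => hb _ (h0 n))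

lemma IsSection.zero (hp : Measurable p) : B.IsSection p fun _ => 0 :=
  (B.sections p hp).zero_mem

lemma IsSection.sub {a b : ∀ y, B.fibre (p y)} (ha : B.IsSection p a)
    (hb : B.IsSection p b) : B.IsSection p fun y => a y - b y :=
  (B.sections p ha.measurable_base).sub_mem ha hb

lemma IsSection.const_smul {b : ∀ y, B.fibre (p y)} (hb : B.IsSection p b) (c : ℂ) :
    B.IsSection p fun y => c • b y :=
  (B.sections p hb.measurable_base).smul_mem c hb

lemma IsSection.smul {b : ∀ y, B.fibre (p y)} (hb : B.IsSection p b) {f : Y → ℂ}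
    (hf : Measurable f) : B.IsSection p fun y => f y • b y := by
  obtain ⟨ξ, hξ⟩ := B.exists_isSection_iff p hb.measurable_base
  refine (hξ _).2 fun n => ?_
  simp only [inner_smul_right]
  exact hf.mul ((hξ b).1 hb n)

lemma IsSection.ite {b : ∀ y, B.fibre (p y)} (hb : B.IsSection p b) {q : Y → Prop}
    [DecidablePred q] (hq : MeasurableSet {y | q y}) :
    B.IsSection p fun y => if q y then b y else 0 := by
  rw [IsSection]
  have h : Measurable fun y => if q y then (⟨p y, b y⟩ : Σ x, B.fibre x) else ⟨p y, 0⟩ :=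
    Measurable.ite hq hb (IsSection.zero hb.measurable_base)
  convert h using 2 with y
  split_ifs <;> rfl

end

end HilbertBundle

/-! ### Square summable sequences of functions -/

lemma measurableSet_summable_sq {Y : Type*} [MeasurableSpace Y] {f : ℕ → Y → ℝ}
    (hf : ∀ k, Measurable (f k)) : MeasurableSet {y | Summable fun k => (f k y) ^ 2} := by
  have : {y | Summable fun k => (f k y) ^ 2} =
      {y | ∑' k, ENNReal.ofReal (f k y ^ 2) < ⊤} := by
    ext y
    refine ⟨fun h => h.tsum_ofReal_lt_top, fun h => ?_⟩
    simpa [sq_nonneg] using ENNReal.summable_toReal (ne_of_lt h)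
  rw [this]
  exact measurableSet_lt (Measurable.tsum fun k => ((hf k).pow_const 2).ennreal_ofReal)
    measurable_const

/-- From a sequence converging to `0` almost everywhere one can select terms which, even after
multiplication by given constants, are square summable almost everywhere. The indices `n k` need not
increase with `k`. -/
lemma exists_seq_ae_summable_sq {α : Type*} [MeasurableSpace α] {μ : Measure α}
    [IsFiniteMeasure μ] {g : ℕ → α → ℝ} (hg : ∀ n, Measurable (g n))
    (h0 : ∀ᵐ a ∂μ, Tendsto (fun n => g n a) atTop (𝓝 0)) (c : ℕ → ℝ) :
    ∃ n : ℕ → ℕ, ∀ᵐ a ∂μ, Summable fun k => (c k * g (n k) a) ^ 2 := by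
  have hm := tendstoInMeasure_of_tendsto_ae (fun n => (hg n).aestronglyMeasurable) h0
  have key (k : ℕ) : ∃ n, μ {a | ENNReal.ofReal ((1 / 2) ^ k / (|c k| + 1)) ≤ edist (g n a) 0} <
      (1 / 2 : ENNReal) ^ k := by
    exact ((tendsto_order.1 (hm _ (by simp; positivity))).2 _ (by simp [ENNReal.pow_pos])).exists
  choose n hn using key
  refine ⟨n, ?_⟩
  -- By Borel-Cantelli, `|cₖ g_{nₖ}| < 2⁻ᵏ` eventually, almost everywhere.
  have hsum :
      ∑' k, μ {a | ENNReal.ofReal ((1 / 2) ^ k / (|c k| + 1)) ≤ edist (g (n k) a) 0} ≠ ⊤ := by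
    refine ne_top_of_le_ne_top ?_ (ENNReal.tsum_le_tsum fun k => (hn k).le)
    rw [ENNReal.tsum_geometric]
    simp
  filter_upwards [ae_eventually_notMem hsum] with a ha
  have hgeo : Summable fun k : ℕ => ((1 / 2 : ℝ) ^ 2) ^ k :=
    summable_geometric_of_lt_one (by norm_num) (by norm_num)
  refine summable_of_isBigO_nat hgeo (Asymptotics.IsBigO.of_bound 1 ?_)
  filter_upwards [ha] with k hk
  simp only [not_le, edist_dist, dist_zero_right] at hk
  have hk := (ENNReal.ofReal_lt_ofReal_iff_of_nonneg (norm_nonneg _)).1 hk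
  have hb : |c k * g (n k) a| ≤ (1 / 2) ^ k := by
    rw [abs_mul]
    rw [lt_div_iff₀ (by positivity), Real.norm_eq_abs] at hk
    nlinarith [abs_nonneg (g (n k) a)]
  rw [one_mul, Real.norm_eq_abs, Real.norm_eq_abs, abs_of_nonneg (sq_nonneg _),
    abs_of_nonneg (by positivity), ← pow_mul, mul_comm 2 k, pow_mul]
  exact sq_le_sq' (by linarith [neg_abs_le (c k * g (n k) a)]) ((le_abs_self _).trans hb)

/-! ### Null sets of arrows and of composable pairs -/

section
variable {X : Type u} [MeasurableSpace X] [Groupoid.{v} X] [MeasurableSpace (Quiver.Total X)]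
  [BorelGroupoid X]

/-- Both marginals of `C^(2)` are absolutely continuous with respect to `C`, which for the first one
is the symmetry of `C`: see `IsSymmetricClass.ae_pairMeasure`. -/
lemma map_snd_pairMeasure (ν : Measure (Quiver.Total X)) [IsProbabilityMeasure ν] :
    (pairMeasure ν).map Prod.snd = ν := by
  have : Nonempty (Quiver.Total X) := nonempty_of_isProbabilityMeasure ν
  have hinv : Measurable (arrowInv : Quiver.Total X → Quiver.Total X) :=
    BorelGroupoid.measurable_inv
  have : IsMarkovKernel (rangeDisintegration ν) := by unfold rangeDisintegration; infer_instance
  have : IsMarkovKernel ((rangeDisintegration ν).map arrowInv) := Kernel.IsMarkovKernel.map _ hinv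
  rw [pairMeasure, Measure.map_comp _ _ measurable_snd, ← Kernel.snd_eq, Kernel.snd_prod]
  exact (condDistrib_comp_map BorelGroupoid.measurable_range.aemeasurable aemeasurable_id).trans
    Measure.map_id

lemma map_fst_pairMeasure (ν : Measure (Quiver.Total X)) [IsProbabilityMeasure ν] :
    (pairMeasure ν).map Prod.fst = ν.map arrowInv := by
  have : Nonempty (Quiver.Total X) := nonempty_of_isProbabilityMeasure ν
  have hinv : Measurable (arrowInv : Quiver.Total X → Quiver.Total X) :=
    BorelGroupoid.measurable_inv
  have : IsMarkovKernel (rangeDisintegration ν) := by unfold rangeDisintegration; infer_instance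
  have : IsMarkovKernel ((rangeDisintegration ν).map arrowInv) := Kernel.IsMarkovKernel.map _ hinv
  rw [pairMeasure, Measure.map_comp _ _ measurable_fst, ← Kernel.fst_eq, Kernel.fst_prod,
    ← Measure.map_comp _ _ hinv]
  congr 1
  exact (condDistrib_comp_map BorelGroupoid.measurable_range.aemeasurable aemeasurable_id).trans
    Measure.map_id

variable {ν : Measure (Quiver.Total X)}

lemma IsSymmetricClass.ae_inv (hν : IsSymmetricClass ν) {P : Quiver.Total X → Prop}
    (h : ∀ᵐ γ ∂ν, P γ) : ∀ᵐ γ ∂ν, P (arrowInv γ) :=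
  ae_of_ae_map BorelGroupoid.measurable_inv.aemeasurable (hν.1.ae_le h)

lemma IsSymmetricClass.ae_pairMeasure [IsProbabilityMeasure ν] (hν : IsSymmetricClass ν)
    {P : Quiver.Total X → Prop} (h : ∀ᵐ γ ∂ν, P γ) :
    ∀ᵐ p ∂(pairMeasure ν), P p.1 ∧ P p.2 := by
  have h1 : ∀ᵐ γ ∂(pairMeasure ν).map Prod.fst, P γ := by
    rw [map_fst_pairMeasure]; exact hν.1.ae_le h
  have h2 : ∀ᵐ γ ∂(pairMeasure ν).map Prod.snd, P γ := by rwa [map_snd_pairMeasure]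
  exact (ae_of_ae_map measurable_fst.aemeasurable h1).and
    (ae_of_ae_map measurable_snd.aemeasurable h2)

lemma ae_range_of_ae_unitMeasure {P : X → Prop} (h : ∀ᵐ x ∂(unitMeasure ν), P x) :
    ∀ᵐ γ ∂ν, P γ.right :=
  ae_of_ae_map BorelGroupoid.measurable_range.aemeasurable h

lemma IsSymmetricClass.ae_source (hν : IsSymmetricClass ν) {P : X → Prop}
    (h : ∀ᵐ x ∂(unitMeasure ν), P x) : ∀ᵐ γ ∂ν, P γ.left :=
  hν.ae_inv (ae_range_of_ae_unitMeasure h)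

end

/-! ### The `ℓ²` sum of a bundle and of a representation -/

lemma memℓp_two_iff {E : ℕ → Type*} [∀ k, NormedAddCommGroup (E k)] {f : ∀ k, E k} :
    Memℓp f 2 ↔ Summable fun k => ‖f k‖ ^ 2 := by
  rw [memℓp_gen_iff (by simp)]
  simp

lemma lp_norm_sq {E : ℕ → Type*} [∀ k, NormedAddCommGroup (E k)] (f : lp E 2) :
    ‖f‖ ^ 2 = ∑' k, ‖f k‖ ^ 2 := by
  simpa using lp.norm_rpow_eq_tsum (p := 2) (by simp) f

section lpMap

variable {E F : Type*} [NormedAddCommGroup E] [InnerProductSpace ℂ E] [NormedAddCommGroup F]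
  [InnerProductSpace ℂ F]

lemma summable_norm_apply_sq (T : E →L[ℂ] F) (a : lp (fun _ : ℕ => E) 2) :
    Summable fun k => ‖T (a k)‖ ^ 2 := by
  refine Summable.of_nonneg_of_le (fun k => sq_nonneg _) (fun k => ?_)
    ((memℓp_two_iff.1 a.2).mul_left (‖T‖ ^ 2))
  rw [← mul_pow]
  exact pow_le_pow_left₀ (norm_nonneg _) (T.le_opNorm _) 2

/-- The operator `⊕ₖ T` on the `ℓ²` sum of countably many copies of a Hilbert space. -/
def lpMap (T : E →L[ℂ] F) : lp (fun _ : ℕ => E) 2 →L[ℂ] lp (fun _ : ℕ => F) 2 :=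
  LinearMap.mkContinuous
    { toFun := fun a => ⟨fun k => T (a k), memℓp_two_iff.2 (summable_norm_apply_sq T a)⟩
      map_add' := fun a b => by ext k; exact map_add T (a k) (b k)
      map_smul' := fun c a => by ext k; exact map_smul T c (a k) } ‖T‖ <| by
    intro a
    refine (sq_le_sq₀ (norm_nonneg _) (by positivity)).1 ?_
    rw [mul_pow, lp_norm_sq, lp_norm_sq, ← tsum_mul_left]
    refine Summable.tsum_le_tsum (fun k => ?_) (summable_norm_apply_sq T a)
      ((memℓp_two_iff.1 a.2).mul_left (‖T‖ ^ 2))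
    rw [← mul_pow]
    exact pow_le_pow_left₀ (norm_nonneg _) (T.le_opNorm _) 2

@[simp] lemma lpMap_apply (T : E →L[ℂ] F) (a : lp (fun _ : ℕ => E) 2) (k : ℕ) :
    lpMap T a k = T (a k) := rfl

lemma norm_lpMap {T : E →L[ℂ] F} (hT : ∀ v, ‖T v‖ = ‖v‖) (a : lp (fun _ : ℕ => E) 2) :
    ‖lpMap T a‖ = ‖a‖ := by
  rw [← sq_eq_sq₀ (norm_nonneg _) (norm_nonneg _), lp_norm_sq, lp_norm_sq]
  simp [hT]

lemma lpMap_surjective {T : E →L[ℂ] F} (hT : ∀ v, ‖T v‖ = ‖v‖) (hs : Function.Surjective T) :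
    Function.Surjective (lpMap T) := by
  intro b
  choose g hg using hs
  refine ⟨⟨fun k => g (b k), memℓp_two_iff.2 ?_⟩, ?_⟩
  · simpa [← hT, hg] using memℓp_two_iff.1 b.2
  · ext k
    exact hg _

end lpMap

namespace HilbertBundle

variable {X : Type u} [MeasurableSpace X] (B : HilbertBundle.{u, w} X)

/-- A vector of the `ℓ²` sum bundle, seen as a sequence of vectors over the same base point. -/
def ellTwoCoord (z : Σ x, lp (fun _ : ℕ => B.fibre x) 2) (k : ℕ) : Σ x, B.fibre x :=
  ⟨z.1, z.2 k⟩

lemma ellTwoCoord_injective : Function.Injective B.ellTwoCoord := by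
  rintro ⟨x, v⟩ ⟨x', v'⟩ h
  obtain rfl : x = x' := congrArg Sigma.fst (congrFun h 0)
  congr 1
  ext k
  simpa [ellTwoCoord] using congrFun h k

lemma range_ellTwoCoord : Set.range B.ellTwoCoord =
    {z | (∀ k, (z k).1 = (z 0).1) ∧ Summable fun k => ‖(z k).2‖ ^ 2} := by
  ext z
  constructor
  · rintro ⟨z, rfl⟩
    exact ⟨fun k => rfl, memℓp_two_iff.1 z.2.2⟩
  · rintro ⟨h1, h2⟩
    have h3 (k : ℕ) : ∃ v : B.fibre (z 0).1, z k = ⟨(z 0).1, v⟩ := by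
      rw [← h1 k]; exact ⟨_, rfl⟩
    choose v hv using h3
    have hn (k : ℕ) : ‖(z k).2‖ = ‖v k‖ :=
      congrArg (fun y : (Σ x, B.fibre x) => ‖y.2‖) (hv k)
    simp only [hn] at h2
    exact ⟨⟨(z 0).1, ⟨v, memℓp_two_iff.2 h2⟩⟩, funext fun k => (hv k).symm⟩

/-- The Borel structure of the `ℓ²` sum bundle: the one for which a family of vectors is Borel iff
its base point and its coordinates are. -/
@[reducible] def ellTwoBorel : MeasurableSpace (Σ x, lp (fun _ : ℕ => B.fibre x) 2) :=
  MeasurableSpace.comap B.ellTwoCoord inferInstance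

variable [StandardBorelSpace X]

lemma measurableSet_range_ellTwoCoord : MeasurableSet (Set.range B.ellTwoCoord) := by
  rw [range_ellTwoCoord, Set.ofPred_and]
  refine MeasurableSet.inter ?_ ?_
  · simp only [Set.ofPred_forall]
    exact MeasurableSet.iInter fun k => measurableSet_eq_fun
      (measurable_fst.comp (measurable_pi_apply k)) (measurable_fst.comp (measurable_pi_apply 0))
  · exact measurableSet_summable_sq fun k => B.measurable_norm_snd.comp (measurable_pi_apply k)

lemma ellTwo_standardBorelSpace :
    @StandardBorelSpace (Σ x, lp (fun _ : ℕ => B.fibre x) 2) B.ellTwoBorel := by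
  let := B.ellTwoBorel
  have hemb : MeasurableEmbedding B.ellTwoCoord :=
    ⟨B.ellTwoCoord_injective, comap_measurable _, by
      rintro _ ⟨t, ht, rfl⟩
      rw [Set.image_preimage_eq_inter_range]
      exact ht.inter B.measurableSet_range_ellTwoCoord⟩
  obtain ⟨τ, _, _⟩ := B.measurableSet_range_ellTwoCoord.standardBorel.polish
  let e := hemb.equivRange
  let : TopologicalSpace (Σ x, lp (fun _ : ℕ => B.fibre x) 2) :=
    TopologicalSpace.induced e inferInstance
  exact ⟨_, e.measurableEmbedding.borelSpace ⟨rfl⟩, e.toEquiv.polishSpace_induced⟩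

/-- The `ℓ²` sum of countably many copies of a Hilbert bundle. -/
def ellTwo : HilbertBundle.{u, w} X :=
  letI := B.ellTwoBorel
  haveI := B.ellTwo_standardBorelSpace
  { fibre := fun x => lp (fun _ : ℕ => B.fibre x) 2
    measurableSet_iff := by
      have hfst : Measurable (Sigma.fst : (Σ x, lp (fun _ : ℕ => B.fibre x) 2) → X) :=
        (measurable_fst (B := B)).comp <|
          (measurable_pi_apply 0).comp (comap_measurable B.ellTwoCoord)
      have hzero : Measurable fun x : X => (⟨x, 0⟩ : Σ x, lp (fun _ : ℕ => B.fibre x) 2) := by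
        refine measurable_comap_iff.2 (measurable_pi_lambda _ fun k => ?_)
        exact IsSection.zero (B := B) measurable_id
      exact fun E => ⟨fun hE => hfst hE, fun hE => hzero hE⟩
    exists_fundamental := by
      obtain ⟨ξ, h0, h1, h2, h3⟩ := B.exists_fundamental
      have hm (k n : ℕ) : Measurable fun x =>
          (⟨x, lp.single 2 k (ξ n x)⟩ : Σ x, lp (fun _ : ℕ => B.fibre x) 2) := by
        refine measurable_comap_iff.2 (measurable_pi_lambda _ fun j => ?_)
        have h0' : Measurable fun x : X => (⟨x, 0⟩ : Σ x, B.fibre x) :=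
          IsSection.zero (B := B) measurable_id
        by_cases hj : j = k
        · subst hj
          simpa [Function.comp_def, ellTwoCoord] using h0 n
        · simpa [Function.comp_def, ellTwoCoord, hj] using h0'
      have hi (k n : ℕ) : Measurable fun z : (Σ x, lp (fun _ : ℕ => B.fibre x) 2) =>
          (inner ℂ (lp.single 2 k (ξ n z.1) : lp (fun _ : ℕ => B.fibre z.1) 2) z.2 : ℂ) := by
        simp only [lp.inner_single_left]
        exact (h1 n).comp ((measurable_pi_apply k).comp (comap_measurable B.ellTwoCoord))
      refine ⟨fun m x => lp.single 2 m.unpair.1 (ξ m.unpair.2 x), fun m => hm _ _,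
        fun m => hi _ _, fun m n => (hi _ _).comp (hm _ _), fun x v v' h => ?_⟩
      ext k
      refine h3 x _ _ fun n => ?_
      have := h (Nat.pair k n)
      simpa only [Nat.unpair_pair, lp.inner_single_left] using this }

lemma ellTwo_isSection_iff {Y : Type*} [MeasurableSpace Y] {p : Y → X}
    {b : ∀ y, lp (fun _ : ℕ => B.fibre (p y)) 2} :
    B.ellTwo.IsSection p b ↔ ∀ k, B.IsSection p fun y => b y k := by
  let := B.ellTwoBorel
  refine (measurable_comap_iff (f := fun y =>
    (⟨p y, b y⟩ : Σ x, lp (fun _ : ℕ => B.fibre x) 2)) (g := B.ellTwoCoord)).trans ?_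
  exact measurable_pi_iff

end HilbertBundle

section

variable {X : Type u} [MeasurableSpace X] [Groupoid.{v} X] [MeasurableSpace (Quiver.Total X)]
  [BorelGroupoid X] {ν : Measure (Quiver.Total X)}

/-- The `ℓ²` sum of countably many copies of a representation. -/
def Representation.ellTwo (L : Representation.{u, v, w} ν) : Representation.{u, v, w} ν where
  bundle := L.bundle.ellTwo
  op γ := lpMap (L.op γ)
  measurable_coeff ξ η hξ hη := by
    have hξ' := L.bundle.ellTwo_isSection_iff.1 hξ
    have hη' := L.bundle.ellTwo_isSection_iff.1 hη
    have hsum (γ : Quiver.Total X) := lp.hasSum_inner (𝕜 := ℂ) (lpMap (L.op γ.hom) (ξ γ.left))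
      (η γ.right)
    refine measurable_of_tendsto_metrizable (fun n => ?_)
      (tendsto_pi_nhds.2 fun γ => (hsum γ).tendsto_sum_nat)
    exact Finset.measurable_sum _ fun k _ => L.measurable_coeff _ _ (hξ' k) (hη' k)
  exists_reduction := by
    obtain ⟨U, hU, hU0, h1, h2, h3⟩ := L.exists_reduction
    refine ⟨U, hU, hU0, fun x hx => ?_, fun x hx y hy γ => ?_, fun x hx y hy z hz γ₁ γ₂ => ?_⟩
    · ext a k
      rw [h1 x hx]
      rfl
    · exact ⟨norm_lpMap (h2 x hx y hy γ).1,
        lpMap_surjective (h2 x hx y hy γ).1 (h2 x hx y hy γ).2⟩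
    · ext a k
      rw [h3 x hx y hy z hz]
      rfl

end

/-! ### Sums of coboundaries and invariant sections -/

section

variable {X : Type u} [MeasurableSpace X] [Groupoid.{v} X] [MeasurableSpace (Quiver.Total X)]
  {ν : Measure (Quiver.Total X)}

/-- If `L` is multiplicative on a reduction, coboundaries satisfy the cocycle identity there. -/
lemma coboundary_comp (L : Representation.{u, v, w} ν) (ξ : ∀ x, L.bundle.fibre x) {x y z : X}
    {γ₁ : y ⟶ x} {γ₂ : z ⟶ y} (h : L.op (γ₂ ≫ γ₁) = (L.op γ₁).comp (L.op γ₂)) :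
    coboundary L ξ ⟨z, x, γ₂ ≫ γ₁⟩ =
      coboundary L ξ ⟨y, x, γ₁⟩ + L.op γ₁ (coboundary L ξ ⟨z, y, γ₂⟩) := by
  simp [coboundary, h]

open scoped Classical in
/-- The cocycle `⊕ₖ c_L(ξₖ)` with values in the `ℓ²` sum, set to be `0` where the
sequence is not square summable. -/
def sumCoboundary (L : Representation.{u, v, w} ν) (ξ : ℕ → ∀ x, L.bundle.fibre x)
    (γ : Quiver.Total X) : lp (fun _ : ℕ => L.bundle.fibre γ.right) 2 :=
  if h : Summable fun k => ‖coboundary L (ξ k) γ‖ ^ 2 then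
    ⟨fun k => coboundary L (ξ k) γ, memℓp_two_iff.2 h⟩
  else 0

lemma sumCoboundary_apply (L : Representation.{u, v, w} ν) {ξ : ℕ → ∀ x, L.bundle.fibre x}
    {γ : Quiver.Total X} (h : Summable fun k => ‖coboundary L (ξ k) γ‖ ^ 2) (k : ℕ) :
    sumCoboundary L ξ γ k = coboundary L (ξ k) γ := by
  rw [sumCoboundary, dif_pos h]

variable [BorelGroupoid X]

lemma isSection_coboundary (L : Representation.{u, v, w} ν) {ξ : ∀ x, L.bundle.fibre x}
    (hξ : L.bundle.IsSection (fun x => x) ξ) :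
    L.bundle.IsSection (fun γ : Quiver.Total X => γ.right) (coboundary L ξ) := by
  refine (hξ.comp BorelGroupoid.measurable_range).sub ?_
  refine HilbertBundle.IsSection.of_forall_inner BorelGroupoid.measurable_range fun η hη => ?_
  simpa only [Function.comp_def, inner_conj_symm] using
    Complex.continuous_conj.measurable.comp (L.measurable_coeff ξ η hξ hη)

lemma isSection_sumCoboundary (L : Representation.{u, v, w} ν) {ξ : ℕ → ∀ x, L.bundle.fibre x}
    (hξ : ∀ k, L.bundle.IsSection (fun x => x) (ξ k)) :
    L.ellTwo.bundle.IsSection (fun γ : Quiver.Total X => γ.right) (sumCoboundary L ξ) := by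
  classical
  refine L.bundle.ellTwo_isSection_iff.2 fun k => ?_
  have hs := measurableSet_summable_sq fun k =>
    (isSection_coboundary L (hξ k)).measurable_norm
  convert (isSection_coboundary L (hξ k)).ite hs using 2 with γ
  split_ifs with h
  · exact sumCoboundary_apply L h k
  · rw [sumCoboundary, dif_neg h]
    rfl

lemma cocycleAE_sumCoboundary [IsProbabilityMeasure ν] (hν : IsSymmetricClass ν)
    (L : Representation.{u, v, w} ν) {ξ : ℕ → ∀ x, L.bundle.fibre x}
    (hξ : ∀ᵐ γ ∂ν, Summable fun k => ‖coboundary L (ξ k) γ‖ ^ 2) :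
    CocycleAE L.ellTwo (sumCoboundary L ξ) := by
  obtain ⟨U, -, hU, -, hiso, hmul⟩ := L.exists_reduction
  have hU' : ∀ᵐ x ∂(unitMeasure ν), x ∈ U := hU
  have hgood := hν.ae_pairMeasure
    (hξ.and ((ae_range_of_ae_unitMeasure hU').and (hν.ae_source hU')))
  filter_upwards [hgood] with p hp x y z γ₁ γ₂ hpe
  subst hpe
  obtain ⟨⟨h1, hx, hy⟩, h2, -, hz⟩ := hp
  have hc (k : ℕ) := coboundary_comp L (ξ k) (hmul x hx y hy z hz γ₁ γ₂)
  have h12 : Summable fun k => ‖coboundary L (ξ k) ⟨z, x, γ₂ ≫ γ₁⟩‖ ^ 2 := by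
    refine Summable.of_nonneg_of_le (fun k => sq_nonneg _) (fun k => ?_)
      ((h1.add h2).mul_left 2)
    rw [hc k]
    have htri := norm_add_le (coboundary L (ξ k) ⟨y, x, γ₁⟩)
      (L.op γ₁ (coboundary L (ξ k) ⟨z, y, γ₂⟩))
    rw [(hiso x hx y hy γ₁).1] at htri
    exact (pow_le_pow_left₀ (norm_nonneg _) htri 2).trans (add_sq_le)
  refine lp.ext (funext fun k => ?_)
  exact (sumCoboundary_apply L h12 k).trans ((hc k).trans (congrArg₂ (· + ·)
    (sumCoboundary_apply L h1 k).symm (congrArg (L.op γ₁) (sumCoboundary_apply L h2 k).symm)))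

/-- If the `L ⊕ L ⊕ ⋯`-cocycle `⊕ₖ c_L(ξₖ)` is a coboundary `c(⊕ₖ ηₖ)`, the sections `ξₖ - ηₖ` are
invariant. -/
lemma exists_invariant_sub [IsProbabilityMeasure ν] (hν : IsSymmetricClass ν)
    (L : Representation.{u, v, w} ν) [hH : Subsingleton (H1 L.ellTwo)]
    {ξ : ℕ → ∀ x, L.bundle.fibre x} (hξ : ∀ k, L.bundle.IsSection (fun x => x) (ξ k))
    (hsum : ∀ᵐ γ ∂ν, Summable fun k => ‖coboundary L (ξ k) γ‖ ^ 2) :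
    ∃ η : ℕ → ∀ x, L.bundle.fibre x, (∀ k, L.bundle.IsSection (fun x => x) (η k)) ∧
      (∀ x, Summable fun k => ‖η k x‖ ^ 2) ∧
      ∀ᵐ γ ∂ν, ∀ k, coboundary L (fun x => ξ k x - η k x) γ = 0 := by
  let b : Z1 L.ellTwo :=
    ⟨sumCoboundary L ξ, isSection_sumCoboundary L hξ, cocycleAE_sumCoboundary hν L hsum⟩
  have hb : b ∈ B1 L.ellTwo := by
    rw [Submodule.Quotient.subsingleton_iff.1 hH]
    trivial
  obtain ⟨η, hη, hbη⟩ := hb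
  let η' (x : X) : lp (fun _ : ℕ => L.bundle.fibre x) 2 := η x
  refine ⟨fun k x => η' x k, L.bundle.ellTwo_isSection_iff.1 hη,
    fun x => memℓp_two_iff.1 (η' x).2, ?_⟩
  filter_upwards [hbη, hsum] with γ h1 h2 k
  have h3 : coboundary L (ξ k) γ = η' γ.right k - L.op γ.hom (η' γ.left k) :=
    (sumCoboundary_apply L h2 k).symm.trans
      (congrArg (fun a : lp (fun _ : ℕ => L.bundle.fibre γ.right) 2 => a k) h1)
  have h4 : coboundary L (fun x => ξ k x - η' x k) γ =
      coboundary L (ξ k) γ - (η' γ.right k - L.op γ.hom (η' γ.left k)) := by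
    simp only [coboundary, map_sub]
    abel
  rw [h4, h3, sub_self]

/-- Invariant sections, one of which is nonzero at almost every point, give an invariant unit
section: normalise at each point the first section that does not vanish there. The index of that
section is itself invariant, as the operators of `L` are isometric. -/
lemma containsUnitInvariantSection_of_seq (hν : IsSymmetricClass ν)
    (L : Representation.{u, v, w} ν) {ζ : ℕ → ∀ x, L.bundle.fibre x}
    (hζ : ∀ k, L.bundle.IsSection (fun x => x) (ζ k))
    (hinv : ∀ᵐ γ ∂ν, ∀ k, coboundary L (ζ k) γ = 0)
    (hne : ∀ᵐ x ∂(unitMeasure ν), ∃ k, ζ k x ≠ 0) : ContainsUnitInvariantSection L := by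
  classical
  -- The second alternative makes the search for an index succeed at every point.
  have hex (x : X) : ∃ k, ζ k x ≠ 0 ∨ ∀ j, ζ j x = 0 := by
    by_cases h : ∃ k, ζ k x ≠ 0
    · exact h.imp fun k hk => Or.inl hk
    · push Not at h
      exact ⟨0, Or.inr h⟩
  have hnorm (k : ℕ) : L.bundle.IsSection (fun x => x) fun x => ((‖ζ k x‖⁻¹ : ℝ) : ℂ) • ζ k x :=
    (hζ k).smul (Complex.measurable_ofReal.comp (hζ k).measurable_norm.inv)
  have hset (k : ℕ) : MeasurableSet {x | ζ k x ≠ 0 ∨ ∀ j, ζ j x = 0} := by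
    have hz (j : ℕ) : MeasurableSet {x | ζ j x = 0} := by
      simpa [Set.compl_ofPred] using (hζ j).measurableSet_ne_zero.compl
    have hall : MeasurableSet {x | ∀ j, ζ j x = 0} := by
      rw [Set.ofPred_forall]
      exact MeasurableSet.iInter hz
    exact (hζ k).measurableSet_ne_zero.union hall
  refine ⟨fun x => ((‖ζ (Nat.find (hex x)) x‖⁻¹ : ℝ) : ℂ) • ζ (Nat.find (hex x)) x,
    ⟨Measurable.find (p := fun k x => ζ k x ≠ 0 ∨ ∀ j, ζ j x = 0) hnorm hset hex, ?_⟩, ?_⟩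
  · filter_upwards [hne] with x hx
    obtain ⟨k, hk⟩ := hx
    have h : ζ (Nat.find (hex x)) x ≠ 0 :=
      (Nat.find_spec (hex x)).resolve_right fun h => hk (h k)
    rw [norm_smul, Complex.norm_real, norm_inv, norm_norm,
      inv_mul_cancel₀ (norm_ne_zero_iff.2 h)]
  · obtain ⟨U, -, hU, -, hiso, -⟩ := L.exists_reduction
    have hU' : ∀ᵐ x ∂(unitMeasure ν), x ∈ U := hU
    filter_upwards [hinv, ae_range_of_ae_unitMeasure hU', hν.ae_source hU'] with γ hγ hr hs
    have hop (k : ℕ) : ζ k γ.right = L.op γ.hom (ζ k γ.left) := sub_eq_zero.1 (hγ k)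
    have hn (k : ℕ) : ‖ζ k γ.right‖ = ‖ζ k γ.left‖ := by
      rw [hop, (hiso _ hr _ hs γ.hom).1]
    have hz (k : ℕ) : ζ k γ.right = 0 ↔ ζ k γ.left = 0 := by
      rw [← norm_eq_zero, hn, norm_eq_zero]
    have hfind : Nat.find (hex γ.right) = Nat.find (hex γ.left) :=
      Nat.find_congr' fun {k} => by simp only [ne_eq, hz]
    rw [hfind, hn, hop, map_smul]

end

end MeasGpd

end

theorem theorem4 {X : Type u} [MeasurableSpace X] [Groupoid.{v} X]
    [MeasurableSpace (Quiver.Total X)] [MeasGpd.BorelGroupoid X]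
    (ν : Measure (Quiver.Total X)) [IsProbabilityMeasure ν]
    (hν : MeasGpd.IsMeasuredGroupoid ν) (herg : MeasGpd.IsErgodic ν)
    (hH : ∀ L : MeasGpd.Representation.{u, v, w} ν, Subsingleton (MeasGpd.H1 L)) :
    MeasGpd.PropertyT.{u, v, w} ν := by
  rintro L ⟨ξ, hξ, hlim⟩
  obtain ⟨n, hn⟩ := MeasGpd.exists_seq_ae_summable_sq
    (fun n => (MeasGpd.isSection_coboundary L (hξ n).1).measurable_norm)
    (hlim.mono fun γ h => by simpa using h.norm) (fun k => k)
  have hsec (k : ℕ) : L.bundle.IsSection (fun x => x) fun x => (k : ℂ) • ξ (n k) x :=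
    (hξ (n k)).1.const_smul k
  have hcob (k : ℕ) (γ : Quiver.Total X) :
      ‖MeasGpd.coboundary L (fun x => (k : ℂ) • ξ (n k) x) γ‖ =
        k * ‖MeasGpd.coboundary L (ξ (n k)) γ‖ := by
    have h : MeasGpd.coboundary L (fun x => (k : ℂ) • ξ (n k) x) γ =
        (k : ℂ) • MeasGpd.coboundary L (ξ (n k)) γ := by
      simp only [MeasGpd.coboundary, map_smul, smul_sub]
    rw [h, norm_smul, Complex.norm_natCast]
  have := hH L.ellTwo
  obtain ⟨η, hη, hη2, hinv⟩ := MeasGpd.exists_invariant_sub hν.symmetric L hsec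
    (by simpa only [hcob] using hn)
  refine MeasGpd.containsUnitInvariantSection_of_seq hν.symmetric L
    (fun k => (hsec k).sub (hη k)) hinv ?_
  filter_upwards [ae_all_iff.2 fun k => (hξ k).2] with x hx
  by_contra! hzero
  -- Otherwise `‖ηₖ(x)‖ = k` for all `k`, which is not square summable.
  have hk (k : ℕ) : ‖η k x‖ ^ 2 = (k : ℝ) ^ 2 := by
    rw [← sub_eq_zero.1 (hzero k), norm_smul, hx, Complex.norm_natCast, mul_one]
  have h0 := (hη2 x).tendsto_atTop_zero
  simp only [hk] at h0
  exact not_tendsto_nhds_of_tendsto_atTop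
    ((tendsto_pow_atTop two_ne_zero).comp tendsto_natCast_atTop_atTop) _ h0
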